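/- **Conventions.** In a groupoid the composite of $a:x\to y$ and $b:y\to z$ is written $ab$. A *crossed complex* $C$ consists of a groupoid $C_1$ with object set $C_0$, families of groups $C_n(x)$ ($x\in C_0$, $n\ge 2$), abelian for $n\ge 3$ (and then written additively), with a right operation $c\mapsto c^a$ of $C_1$ on each family $C_n$, and operation-preserving homomorphisms $\delta_2:C_2(x)\to C_1(x,x)$ and $\delta_n:C_n(x)\to C_{n-1}(x)$ for $n\ge3$, such that $\delta_2:C_2\to C_1$ is a crossed module, $\delta\delta$ is trivial, and $\delta_2C_2$ operates trivially on $C_n$ for $n\ge3$. It is *$m$-truncated* if only the dimensions $n\le m$ occur. $C$ is *free* on subgraphs $X_n\subseteq C_n$ if $C_1$ is the free groupoid on $X_1$, $C_2$ is the free crossed $C_1$-module on $\delta_2|_{X_2}:X_2\to C_1$, and for $n\ge3$, $C_n$ is the free module on $X_n$ over the quotient groupoid $C_1/\delta_2C_2$. For $c\in C_n(x)$, $n\ge 2$, put $\beta c=x$; for an arrow $a$ of $C_1$ let $\delta^0a$, $\delta^1a$ be its source and target. Let $G$ be a group and $m\ge1$. An *$m$-truncated free crossed resolution* of $G$ is an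 $m$-truncated crossed complex $C$ with a single object, free on $X_1,\dots,X_m$, with a surjective morphism $\varphi:C_1\to G$ such that $C_m\to\cdots\to C_2\to C_1\xrightarrow{\varphi}G$ is exact at $C_1,\dots,C_{m-1}$. The *universal covering groupoid* $\widetilde G$ of $G$ has object set $G$ and arrows $(g,k):g\to gk$, with projection $(g,k)\mapsto k$. A *universal cover* $p:\widetilde C\to C$ is a covering morphism of crossed complexes (bijective on stars in dimension $1$, bijective on the groups in dimensions $\ge2$) together with a morphism $\widetilde C_1\to\widetilde G$ which is bijective on objects and lies over $\varphi$. A *partial contracting homotopy* $h$ of $\widetilde C$ onto an object $0$ of $\widetilde C$ is a family of functions $h_n:\widetilde C_n\to\widetilde C_{n+1}$, $0\le n<m$, such that, in so far as the functions involved are defined: $h_0(x)$ is an arrow $x\to0$, and $h_n$ takes values in $\widetilde C_{n+1}(0)$ for $n\ge1$; $h_1$ is a morphism of groupoids; $h_n$ is a homomorphism on each group $\widetilde C_n(x)$ and $h_n(c^{a})=h_n(c)$ for $n\ge2$; and $$\widetilde\delta_2h_1(a)=(h_0\widetilde\delta^0a)^{-1}\,a\,(h_0\widetilde\delta^1a),\qquad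 \widetilde\delta_3h_2(c)=(h_1\widetilde\delta_2c)^{-1}\,c^{h_0\beta c},\qquad \widetilde\delta_{n+1}h_n(c)=-h_{n-1}\widetilde\delta_nc+c^{h_0\beta c}\ (n\ge3).$$ **Statement.** Let $C$ be an $m$-truncated free crossed resolution of $G$, free on $X_1,\dots,X_m$, let $p:\widetilde C\to C$ be a universal cover, let $h$ be a partial contracting homotopy of $\widetilde C$, and let $\widetilde X_m$ be either the covering basis $p^{-1}(X_m)$ or any other subgraph of $\widetilde C_m$ on which $\widetilde C_m$ is free. Then: 1. If $m=1$, the kernel of $\varphi:C_1\to G$ is generated, as a normal subgroup of $C_1$, by the elements $$p_1\big((h_0\widetilde\delta^0\tilde x)^{-1}\,\tilde x\,(h_0\widetilde\delta^1\tilde x)\big),\qquad \tilde x\in\widetilde X_1 .$$ 2. If $m\ge2$, the elements $$p_2\big((h_1\widetilde\delta_2\tilde x)^{-1}\,\tilde x^{\,h_0\beta\tilde x}\big),\ \ \tilde x\in\widetilde X_2\quad(m=2),\qquad\qquad p_m\big(-h_{m-1}\widetilde\delta_m\tilde x+\tilde x^{\,h_0\beta\tilde x}\big),\ \ \tilde x\in\widetilde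 X_m\quad(m\ge3),$$ lie in $\operatorname{Ker}(\delta_m:C_m\to C_{m-1})$ and generate it as a $G$-module, where $G$ operates on $\operatorname{Ker}\delta_m$ through $\varphi$: $c^{g}=c^{a}$ for any $a\in C_1$ with $\varphi(a)=g$. -/

import Mathlib

open CategoryTheory

universe u

/-- A family of groups `carrier x`, indexed by the objects of a groupoid `Φ`, with a right operation
of `Φ`: an arrow `a : x ⟶ y` carries `c : carrier x` to `c ^ a = act a c : carrier y`.  Composition
of arrows is written in diagrammatic order, so that `(c ^ a) ^ b = c ^ (a ≫ b)`. -/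
structure OpGroups (Φ : Type u) [Groupoid.{u} Φ] where
  carrier : Φ → Type u
  [group : ∀ x, Group (carrier x)]
  act : ∀ {x y : Φ}, (x ⟶ y) → (carrier x →* carrier y)
  act_id : ∀ (x : Φ) (c : carrier x), act (𝟙 x) c = c
  act_comp : ∀ {x y z : Φ} (a : x ⟶ y) (b : y ⟶ z) (c : carrier x),
    act (a ≫ b) c = act b (act a c)

attribute [instance] OpGroups.group

/-- A crossed module over the groupoid `Φ`.  The vertex group `x ⟶ x` carries Mathlib's
multiplication `a * b = a ≫ b`. -/
structure GroupoidCrossedModule (Φ : Type u) [Groupoid.{u} Φ] extends OpGroups Φ where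
  bdry : ∀ x : Φ, carrier x →* (x ⟶ x)
  bdry_act : ∀ {x y : Φ} (a : x ⟶ y) (c : carrier x),
    bdry y (act a c) = Groupoid.inv a ≫ bdry x c ≫ a
  peiffer : ∀ {x : Φ} (c d : carrier x), act (bdry x d) c = d⁻¹ * c * d

/-- A crossed complex over a groupoid.  `C.Obj` is the set `C₀`, the groupoid structure on it is
`C₁`, and `C.ops n` is the family of groups `C_{n+2}` with its `C₁`-operation.  The groups are
written multiplicatively in every dimension; they are commutative in dimensions `≥ 3`. -/
structure CrossedComplex where
  Obj : Type u
  [gpd : Groupoid.{u} Obj]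
  ops : ℕ → OpGroups Obj
  /-- the boundary `C₂ → C₁` -/
  bdryTwo : ∀ x : Obj, (ops 0).carrier x →* (x ⟶ x)
  /-- the boundary `C_{n+3} → C_{n+2}` -/
  bdry : ∀ (n : ℕ) (x : Obj), (ops (n + 1)).carrier x →* (ops n).carrier x
  bdryTwo_act : ∀ {x y : Obj} (a : x ⟶ y) (c : (ops 0).carrier x),
    bdryTwo y ((ops 0).act a c) = Groupoid.inv a ≫ bdryTwo x c ≫ a
  peiffer : ∀ {x : Obj} (c d : (ops 0).carrier x),
    (ops 0).act (bdryTwo x d) c = d⁻¹ * c * d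
  comm : ∀ (n : ℕ) (x : Obj) (c d : (ops (n + 1)).carrier x), c * d = d * c
  bdry_act : ∀ (n : ℕ) {x y : Obj} (a : x ⟶ y) (c : (ops (n + 1)).carrier x),
    bdry n y ((ops (n + 1)).act a c) = (ops n).act a (bdry n x c)
  bdryTwo_bdry : ∀ (x : Obj) (c : (ops 1).carrier x), bdryTwo x (bdry 0 x c) = 1
  bdry_bdry : ∀ (n : ℕ) (x : Obj) (c : (ops (n + 2)).carrier x),
    bdry n x (bdry (n + 1) x c) = 1
  bdryTwo_act_trivial : ∀ (n : ℕ) {x : Obj} (d : (ops 0).carrier x)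
    (c : (ops (n + 1)).carrier x), (ops (n + 1)).act (bdryTwo x d) c = c

attribute [instance] CrossedComplex.gpd

namespace CrossedComplex

/-- An `m`-truncated crossed complex (`m ≥ 1`) is regarded as a crossed complex whose groups
`C_{n+2}` are trivial in the dimensions `n + 2 > m`. -/
def IsTruncated (C : CrossedComplex.{u}) (m : ℕ) : Prop :=
  ∀ (n : ℕ) (x : C.Obj), m < n + 2 → Subsingleton ((C.ops n).carrier x)

/-- The kernel of the boundary `C_{k+2}(x) → C_{k+1}(x)`. -/
def bdryKer (C : CrossedComplex.{u}) : (k : ℕ) → (x : C.Obj) → Subgroup ((C.ops k).carrier x)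
  | 0, x => (C.bdryTwo x).ker
  | k + 1, x => (C.bdry k x).ker

/-- Subgraphs `X_n ⊆ C_n` for `n ≥ 1`: a set of arrows of `C₁`, and sets of elements of the
groups `C_{n+2}(x)`. -/
structure GradedSubset (C : CrossedComplex.{u}) where
  arr : ∀ x y : C.Obj, Set (x ⟶ y)
  elt : ∀ (n : ℕ) (x : C.Obj), Set ((C.ops n).carrier x)

/-- The groupoid `C₁` is the free groupoid on the graph `X₁` of arrows: any graph morphism from
`X₁` to a groupoid `D` (with object part `F₀`) extends uniquely to a morphism of groupoids. -/
def IsFreeGroupoidOn (C : CrossedComplex.{u}) (X : ∀ x y : C.Obj, Set (x ⟶ y)) : Prop :=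
  ∀ (D : Type u) [Groupoid.{u} D] (F₀ : C.Obj → D) (f : ∀ x y, X x y → (F₀ x ⟶ F₀ y)),
    ∃! F : ∀ x y : C.Obj, (x ⟶ y) → (F₀ x ⟶ F₀ y),
      (∀ x, F x x (𝟙 x) = 𝟙 (F₀ x)) ∧
      (∀ x y z (a : x ⟶ y) (b : y ⟶ z), F x z (a ≫ b) = F x y a ≫ F y z b) ∧
      ∀ x y (e : X x y), F x y e = f x y e

/-- `C₂` is the free crossed `C₁`-module on the restriction `X₂ → C₁` of the boundary. -/
def IsFreeCrossedModuleOn (C : CrossedComplex.{u})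
    (X : ∀ x : C.Obj, Set ((C.ops 0).carrier x)) : Prop :=
  ∀ (M : GroupoidCrossedModule C.Obj) (g : ∀ x, X x → M.carrier x),
    (∀ x (r : X x), M.bdry x (g x r) = C.bdryTwo x r) →
    ∃! f : ∀ x, (C.ops 0).carrier x →* M.carrier x,
      (∀ x y (a : x ⟶ y) (c : (C.ops 0).carrier x), f y ((C.ops 0).act a c) = M.act a (f x c)) ∧
      (∀ x (c : (C.ops 0).carrier x), M.bdry x (f x c) = C.bdryTwo x c) ∧
      ∀ x (r : X x), f x r = g x r

/-- `C_{n+3}` is the free `π₁C`-module on `X_{n+3}`.  Here `π₁C` is the quotient of `C₁` by the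
image of the boundary of `C₂`, so that a `π₁C`-module is a family of abelian groups with an
operation of `C₁` for which the image of the boundary of `C₂` operates trivially. -/
def IsFreeModuleOn (C : CrossedComplex.{u}) (n : ℕ)
    (X : ∀ x : C.Obj, Set ((C.ops (n + 1)).carrier x)) : Prop :=
  ∀ (A : OpGroups C.Obj),
    (∀ x (c d : A.carrier x), c * d = d * c) →
    (∀ x (d : (C.ops 0).carrier x) (c : A.carrier x), A.act (C.bdryTwo x d) c = c) →
    ∀ g : ∀ x, X x → A.carrier x,
    ∃! f : ∀ x, (C.ops (n + 1)).carrier x →* A.carrier x,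
      (∀ x y (a : x ⟶ y) (c : (C.ops (n + 1)).carrier x),
        f y ((C.ops (n + 1)).act a c) = A.act a (f x c)) ∧
      ∀ x (r : X x), f x r = g x r

/-- `C_n` is free on `X_n` (no condition for `n = 0`, where `X₀ = C₀`). -/
def IsFreeInDim (C : CrossedComplex.{u}) (X : C.GradedSubset) : ℕ → Prop
  | 0 => True
  | 1 => C.IsFreeGroupoidOn X.arr
  | 2 => C.IsFreeCrossedModuleOn (X.elt 0)
  | n + 3 => C.IsFreeModuleOn n (X.elt (n + 1))

/-- A morphism of crossed complexes. -/
structure Hom (C D : CrossedComplex.{u}) where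
  functor : C.Obj ⥤ D.Obj
  map : ∀ (n : ℕ) (x : C.Obj), (C.ops n).carrier x →* (D.ops n).carrier (functor.obj x)
  map_act : ∀ (n : ℕ) {x y : C.Obj} (a : x ⟶ y) (c : (C.ops n).carrier x),
    map n y ((C.ops n).act a c) = (D.ops n).act (functor.map a) (map n x c)
  map_bdryTwo : ∀ (x : C.Obj) (c : (C.ops 0).carrier x),
    functor.map (C.bdryTwo x c) = D.bdryTwo (functor.obj x) (map 0 x c)
  map_bdry : ∀ (n : ℕ) (x : C.Obj) (c : (C.ops (n + 1)).carrier x),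
    map n x (C.bdry n x c) = D.bdry n (functor.obj x) (map (n + 1) x c)

/-- A covering morphism of crossed complexes: bijective on the stars of the groupoids in
dimension one, and an isomorphism on the groups in dimensions `≥ 2`. -/
structure Hom.IsCovering {C D : CrossedComplex.{u}} (p : Hom C D) : Prop where
  star : ∀ x : C.Obj, Function.Bijective (p.functor.toPrefunctor.star x)
  groups : ∀ (n : ℕ) (x : C.Obj), Function.Bijective (p.map n x)

/-- The inverse image `p⁻¹(X)` of a graded subset along a morphism. -/
def Hom.preimage {C D : CrossedComplex.{u}} (p : Hom C D) (X : D.GradedSubset) :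
    C.GradedSubset where
  arr x y := {a | p.functor.map a ∈ X.arr (p.functor.obj x) (p.functor.obj y)}
  elt n x := {c | p.map n x c ∈ X.elt n (p.functor.obj x)}

end CrossedComplex

/-- A morphism from a groupoid to a group (regarded as a groupoid with one object, the composite of
arrows `a`, `b` being the product `a * b`). -/
structure GroupoidToGroup (Φ : Type u) [Groupoid.{u} Φ] (G : Type u) [Group G] where
  map : ∀ {x y : Φ}, (x ⟶ y) → G
  map_id : ∀ x : Φ, map (𝟙 x) = 1
  map_comp : ∀ {x y z : Φ} (a : x ⟶ y) (b : y ⟶ z), map (a ≫ b) = map a * map b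

/-- The restriction of a morphism `Φ → G` to the vertex group at `x`. -/
def GroupoidToGroup.vertexHom {Φ : Type u} [Groupoid.{u} Φ] {G : Type u} [Group G]
    (φ : GroupoidToGroup Φ G) (x : Φ) : (x ⟶ x) →* G where
  toFun a := φ.map a
  map_one' := φ.map_id x
  map_mul' a b := φ.map_comp a b

/-- The objects of the universal covering groupoid of a group `G`: the elements of `G`. -/
structure UnivCoverGroupoid (G : Type u) where
  pt : G

/-- The arrows `g ⟶ g'` of the universal covering groupoid are the elements `k` with `g k = g'`
(that is, the pairs `(g, k)` with source `g` and target `g k`). -/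
instance UnivCoverGroupoid.groupoid (G : Type u) [Group G] :
    Groupoid.{u} (UnivCoverGroupoid G) where
  Hom g g' := {k : G // g.pt * k = g'.pt}
  id g := ⟨1, mul_one _⟩
  comp a b := ⟨a.1 * b.1, by rw [← mul_assoc, a.2, b.2]⟩
  inv a := ⟨a.1⁻¹, mul_inv_eq_iff_eq_mul.mpr a.2.symm⟩
  id_comp a := Subtype.ext (one_mul _)
  comp_id a := Subtype.ext (mul_one _)
  assoc a b c := Subtype.ext (mul_assoc _ _ _)
  inv_comp a := Subtype.ext (inv_mul_cancel _)
  comp_inv a := Subtype.ext (mul_inv_cancel _)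

/-- The universal covering morphism of groupoids, which maps the arrow `(g, k)` to `k`. -/
def UnivCoverGroupoid.proj (G : Type u) [Group G] : GroupoidToGroup (UnivCoverGroupoid G) G where
  map a := a.1
  map_id _ := rfl
  map_comp _ _ := rfl

/-- An `m`-truncated free crossed resolution of the group `G` (`m ≥ 1`): an `m`-truncated crossed
complex `C` with exactly one object, free on a graded basis `X` in the dimensions `1, …, m`, with an
epimorphism `φ : C₁ → G`, such that `C_m → ⋯ → C₂ → C₁ → G` is exact at `C₁, …, C_{m-1}`. -/
structure FreeCrossedResolution (G : Type u) [Group G] (m : ℕ) where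
  C : CrossedComplex.{u}
  exists_unique_obj : ∃! _x : C.Obj, True
  truncated : C.IsTruncated m
  X : C.GradedSubset
  free : ∀ n, 1 ≤ n → n ≤ m → C.IsFreeInDim X n
  φ : GroupoidToGroup C.Obj G
  φ_surjective : ∀ x : C.Obj, Function.Surjective (φ.vertexHom x)
  exact_one : 2 ≤ m → ∀ x : C.Obj, (C.bdryTwo x).range = (φ.vertexHom x).ker
  exact : ∀ n, n + 3 ≤ m → ∀ x : C.Obj, (C.bdry n x).range = C.bdryKer n x

/-- `p : C' → C` is the universal cover of `C` relative to `φ : C₁ → G`, where `C` has one object: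
the covering crossed complex which corresponds to the universal covering groupoid of `G`.  That is,
`p` is a covering morphism, and there is a morphism of groupoids from `C'₁` to the universal covering
groupoid of `G` which is bijective on objects and lies over `φ`.  (As both vertical morphisms are
coverings, the square formed with `φ` is then a pullback.) -/
structure CrossedComplex.Hom.IsUniversalCover {C' C : CrossedComplex.{u}} (p : Hom C' C)
    {G : Type u} [Group G] (φ : GroupoidToGroup C.Obj G) : Prop where
  covering : p.IsCovering
  lift : ∃ φ' : C'.Obj ⥤ UnivCoverGroupoid G, Function.Bijective φ'.obj ∧
    ∀ {x y : C'.Obj} (a : x ⟶ y),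
      (UnivCoverGroupoid.proj G).map (φ'.map a) = φ.map (p.functor.map a)

/-- A partial contracting homotopy of an `m`-truncated crossed complex `C`, contracting it to the
object `base`: functions `h_n : C_n → C_{n+1}(base)`, where `hzero`, `hone`, `h n` are `h₀`, `h₁`,
`h_{n+2}`.  The conditions are those in which only `h_n` with `n < m` occur.  (For `n ≥ m` the group
`C_{n+1}(base)` is trivial and `h_n` carries no information.) -/
structure PartialContractingHomotopy (C : CrossedComplex.{u}) (m : ℕ) where
  base : C.Obj
  hzero : ∀ x : C.Obj, x ⟶ base
  hone : ∀ {x y : C.Obj}, (x ⟶ y) → (C.ops 0).carrier base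
  h : ∀ (n : ℕ) (x : C.Obj), (C.ops n).carrier x →* (C.ops (n + 1)).carrier base
  hone_comp : 1 < m → ∀ {x y z : C.Obj} (a : x ⟶ y) (b : y ⟶ z),
    hone (a ≫ b) = hone a * hone b
  bdryTwo_hone : 1 < m → ∀ {x y : C.Obj} (a : x ⟶ y),
    C.bdryTwo base (hone a) = Groupoid.inv (hzero x) ≫ a ≫ hzero y
  h_act : ∀ n, n + 2 < m → ∀ {x y : C.Obj} (a : x ⟶ y) (c : (C.ops n).carrier x),
    h n y ((C.ops n).act a c) = h n x c
  bdry_h_zero : 2 < m → ∀ (x : C.Obj) (c : (C.ops 0).carrier x),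
    C.bdry 0 base (h 0 x c) = (hone (C.bdryTwo x c))⁻¹ * (C.ops 0).act (hzero x) c
  bdry_h_succ : ∀ n, n + 3 < m → ∀ (x : C.Obj) (c : (C.ops (n + 1)).carrier x),
    C.bdry (n + 1) base (h (n + 1) x c) =
      (h n x (C.bdry n x c))⁻¹ * (C.ops (n + 1)).act (hzero x) c

namespace PartialContractingHomotopy

variable {C : CrossedComplex.{u}} {m : ℕ} (H : PartialContractingHomotopy C m)

/-- For an arrow `a` with source `x` and target `y`: the loop `(h₀ x)⁻¹ a (h₀ y)` at `base`. -/
def loop {x y : C.Obj} (a : x ⟶ y) : H.base ⟶ H.base :=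
  Groupoid.inv (H.hzero x) ≫ a ≫ H.hzero y

/-- For `c` in `C_{k+2}(x)`: the element `(h_{k+1} (δ_{k+2} c))⁻¹ · c ^ (h₀ x)` of
`C_{k+2}(base)`; in additive notation `- h_{k+1} (δ_{k+2} c) + c ^ (h₀ x)`. -/
def syzygy : (k : ℕ) → (x : C.Obj) → (C.ops k).carrier x → (C.ops k).carrier H.base
  | 0, x, c => (H.hone (C.bdryTwo x c))⁻¹ * (C.ops 0).act (H.hzero x) c
  | k + 1, x, c => (H.h k x (C.bdry k x c))⁻¹ * (C.ops (k + 1)).act (H.hzero x) c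

end PartialContractingHomotopy

/-! ### The `G`-module structure on the kernels of the boundaries -/

namespace CrossedComplex

variable (C : CrossedComplex.{u})

theorem bdryKer_comm (k : ℕ) (x : C.Obj) (c d : C.bdryKer k x) : c * d = d * c := by
  cases k with
  | zero =>
    apply Subtype.ext
    have hd : C.bdryTwo x d.1 = 1 := d.2
    have h := C.peiffer c.1 d.1
    rw [hd] at h
    have h1 : (C.ops 0).act (1 : x ⟶ x) c.1 = c.1 := (C.ops 0).act_id x c.1
    rw [h1] at h
    change c.1 * d.1 = d.1 * c.1
    conv_rhs => rw [h]
    group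
  | succ k => exact Subtype.ext (C.comm k x c.1 d.1)

instance bdryKerCommGroup (k : ℕ) (x : C.Obj) : CommGroup (C.bdryKer k x) :=
  { (inferInstance : Group (C.bdryKer k x)) with mul_comm := C.bdryKer_comm k x }

theorem act_mem_bdryKer (k : ℕ) {x y : C.Obj} (a : x ⟶ y) {c : (C.ops k).carrier x}
    (hc : c ∈ C.bdryKer k x) : (C.ops k).act a c ∈ C.bdryKer k y := by
  cases k with
  | zero =>
    have hc' : C.bdryTwo x c = 1 := hc
    change C.bdryTwo y _ = 1
    rw [C.bdryTwo_act, hc']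
    change Groupoid.inv a ≫ 𝟙 x ≫ a = 𝟙 y
    simp
  | succ k =>
    have hc' : C.bdry k x c = 1 := hc
    change C.bdry k y _ = 1
    rw [C.bdry_act, hc', map_one]

theorem act_bdryTwo_of_mem (k : ℕ) {x : C.Obj} (d : (C.ops 0).carrier x)
    {c : (C.ops k).carrier x} (hc : c ∈ C.bdryKer k x) : (C.ops k).act (C.bdryTwo x d) c = c := by
  cases k with
  | zero =>
    have hc' : C.bdryTwo x c = 1 := hc
    have h := C.peiffer d c
    rw [hc'] at h
    have h1 : (C.ops 0).act (1 : x ⟶ x) d = d := (C.ops 0).act_id x d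
    rw [h1] at h
    have h2 : c * d = d * c := by
      conv_lhs => rw [h]
      group
    rw [C.peiffer, mul_assoc, h2, inv_mul_cancel_left]
  | succ k => exact C.bdryTwo_act_trivial k d c

end CrossedComplex

namespace FreeCrossedResolution

variable {G : Type u} [Group G] {m : ℕ} (R : FreeCrossedResolution G m)

/-- The operation of `C₁` on the kernel of a boundary factors through `φ : C₁ → G`. -/
theorem act_eq_of_map_eq (hm : 2 ≤ m) (k : ℕ) (x : R.C.Obj) {a b : x ⟶ x}
    (hab : R.φ.vertexHom x a = R.φ.vertexHom x b) {c : (R.C.ops k).carrier x}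
    (hc : c ∈ R.C.bdryKer k x) : (R.C.ops k).act a c = (R.C.ops k).act b c := by
  have h : a * b⁻¹ ∈ (R.φ.vertexHom x).ker := by
    rw [MonoidHom.mem_ker, map_mul, map_inv, hab, mul_inv_cancel]
  rw [← R.exact_one hm x] at h
  obtain ⟨d, hd⟩ := h
  have h1 := R.C.act_bdryTwo_of_mem k d hc
  rw [hd] at h1
  have h2 : a = (a * b⁻¹) ≫ b := by
    change a = (a * b⁻¹) * b
    group
  rw [h2, (R.C.ops k).act_comp, h1]

/-- The right operation of `G` on the kernel of `C_{k+2}(x) → C_{k+1}(x)`, as a left operation of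
the opposite group: `c ^ g` is `c ^ a` for any `a` in `C₁` with `φ a = g`. -/
noncomputable abbrev kerAction (hm : 2 ≤ m) (k : ℕ) (x : R.C.Obj) :
    MulDistribMulAction Gᵐᵒᵖ (R.C.bdryKer k x) where
  smul g c := ⟨(R.C.ops k).act (Function.surjInv (R.φ_surjective x) g.unop) c.1,
    R.C.act_mem_bdryKer k _ c.2⟩
  one_smul c := by
    apply Subtype.ext
    refine (R.act_eq_of_map_eq hm k x (b := 𝟙 x) ?_ c.2).trans ((R.C.ops k).act_id x c.1)
    exact (Function.surjInv_eq (R.φ_surjective x) _).trans (map_one (R.φ.vertexHom x)).symm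
  mul_smul g g' c := by
    apply Subtype.ext
    refine (R.act_eq_of_map_eq hm k x ?_ c.2).trans ((R.C.ops k).act_comp _ _ c.1)
    have h := Function.surjInv_eq (R.φ_surjective x)
    exact (h _).trans (((map_mul (R.φ.vertexHom x) _ _).trans
      (congrArg₂ (· * ·) (h g'.unop) (h g.unop))).symm)
  smul_one g := Subtype.ext (map_one _)
  smul_mul g c d := Subtype.ext (map_mul _ _ _)

theorem kerAction_smul_coe (hm : 2 ≤ m) (k : ℕ) (x : R.C.Obj) (a : x ⟶ x)
    (c : R.C.bdryKer k x) :
    (((R.kerAction hm k x).smul (MulOpposite.op (R.φ.map a)) c : R.C.bdryKer k x) :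
      (R.C.ops k).carrier x) = (R.C.ops k).act a c.1 := by
  exact R.act_eq_of_map_eq hm k x (Function.surjInv_eq (R.φ_surjective x) (R.φ.map a)) c.2

/-- The kernel of `C_{k+2}(x) → C_{k+1}(x)`, written additively, as a right `G`-module, that is, as
a representation of the opposite group of `G` over `ℤ`. -/
noncomputable def kerRep (hm : 2 ≤ m) (k : ℕ) (x : R.C.Obj) :
    Representation ℤ Gᵐᵒᵖ (Additive (R.C.bdryKer k x)) :=
  letI := R.kerAction hm k x
  Representation.ofMulDistribMulAction Gᵐᵒᵖ (R.C.bdryKer k x)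

/-- The kernel of `C_{k+2}(x) → C_{k+1}(x)` is generated, as a `G`-module, by those of its elements
which lie in `S`: they span it over the integral group ring (of the opposite group, as `G` operates
on the right). -/
def KerGeneratedBy (hm : 2 ≤ m) (k : ℕ) (x : R.C.Obj) (S : Set ((R.C.ops k).carrier x)) : Prop :=
  Submodule.span (MonoidAlgebra ℤ Gᵐᵒᵖ)
    {v : (R.kerRep hm k x).asModule |
      (((R.kerRep hm k x).asModuleEquiv v).toMul : (R.C.ops k).carrier x) ∈ S} = ⊤

end FreeCrossedResolution

/-!
Write `D` for the cover and `o` for the object onto which it contracts.  In dimension `m = k + 2`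
the map `c ↦ syzygy c` is a homomorphism from each group `D_m(x)` to the kernel of the boundary at
`o` (`syzygy_mem_bdryKer`, `syzygyHom`).  It does not see the operation of `D₁` (`syzygy_act`):
the loop which `h₀` makes of an arrow is a boundary `δ₂ h₁ a`, so it operates trivially for `m ≥ 3`
and by conjugation for `m = 2`, where the kernel is central.  On the kernel itself the map is the
operation of the loop `h₀ o` (`syzygy_of_mem`), hence it is onto.  So any subset which generates
`D_m` under the group laws and the operation of `D₁` has syzygies which generate the kernel, even as
a group.  The projection identifies this kernel with that of `C`.  In dimension one the argument is
the same, with the functor `a ↦ loop a` in place of the syzygies; an element of `Ker φ` lifts to a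
loop at `o` because the objects of the cover are the elements of `G`.

It remains to see that the given subset generates.  A free basis generates, since the universal
property applies to the subobject generated and its uniqueness part shows the inclusion of this
subobject to be onto (`Subgroupoid.mem_of_isFreeGroupoidOn`, `mem_of_isFreeInDim`).  The inverse
image of a generating set under a covering generates, by unique lifting of arrows
(`Hom.IsCovering.pushSubgroupoid`, `Hom.IsCovering.pushSubgroup`).
-/

/-! ### Free bases generate -/

/-- A wide subgroupoid which contains a free basis is everything. -/
theorem CategoryTheory.Subgroupoid.mem_of_isFreeGroupoidOn {C : CrossedComplex.{u}}
    {X : ∀ x y : C.Obj, Set (x ⟶ y)} (hX : C.IsFreeGroupoidOn X) (S : Subgroupoid C.Obj)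
    (hS : S.IsWide) (hXS : ∀ x y, X x y ⊆ S.arrows x y) {x y : C.Obj} (a : x ⟶ y) :
    a ∈ S.arrows x y := by
  let F₀ : C.Obj → S.objs := fun x => ⟨x, 𝟙 x, hS.wide x⟩
  obtain ⟨F, ⟨F_id, F_comp, F_X⟩, -⟩ :=
    hX S.objs F₀ (fun x y e => (⟨e.1, hXS x y e.2⟩ : S.arrows x y))
  -- `F` followed by the inclusion of `S` and the identity both extend the inclusion of `X`.
  have h := (hX C.Obj id (fun _ _ e => e.1)).unique
    (y₁ := fun x y a => (show S.arrows x y from F x y a).1) (y₂ := fun _ _ a => a)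
    ⟨fun x => congrArg Subtype.val (F_id x),
      fun x y z a b => congrArg Subtype.val (F_comp x y z a b),
      fun x y e => congrArg Subtype.val (F_X x y e)⟩
    ⟨fun _ => rfl, fun _ _ _ _ _ => rfl, fun _ _ _ => rfl⟩
  have h' := congrFun (congrFun (congrFun h x) y) a
  exact h' ▸ (show S.arrows x y from F x y a).2

/-- A family of subgroups which is closed under the operation of the groupoid. -/
def OpGroups.sub {Φ : Type u} [Groupoid.{u} Φ] (A : OpGroups Φ)
    (S : ∀ x, Subgroup (A.carrier x))
    (hS : ∀ {x y : Φ} (a : x ⟶ y), ∀ c ∈ S x, A.act a c ∈ S y) : OpGroups Φ where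
  carrier x := S x
  act {x y} a := ((A.act a).comp (S x).subtype).codRestrict (S y) fun c => hS a c.1 c.2
  act_id x c := Subtype.ext (A.act_id x c.1)
  act_comp a b c := Subtype.ext (A.act_comp a b c.1)

namespace CrossedComplex

/-- A family of subgroups of `C_{k+2}` which is closed under the operation of `C₁` and contains a
free basis is everything. -/
theorem mem_of_isFreeInDim {C : CrossedComplex.{u}} {X : C.GradedSubset} {k : ℕ}
    (hX : C.IsFreeInDim X (k + 2)) (S : ∀ x, Subgroup ((C.ops k).carrier x))
    (hS : ∀ {x y : C.Obj} (a : x ⟶ y), ∀ c ∈ S x, (C.ops k).act a c ∈ S y)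
    (hXS : ∀ x, ∀ c ∈ X.elt k x, c ∈ S x) {x : C.Obj} (c : (C.ops k).carrier x) : c ∈ S x := by
  cases k with
  | zero =>
    let M : GroupoidCrossedModule C.Obj :=
      { toOpGroups := (C.ops 0).sub S hS
        bdry := fun x => (C.bdryTwo x).comp (S x).subtype
        bdry_act := fun a c => C.bdryTwo_act a c.1
        peiffer := fun c d => Subtype.ext (C.peiffer c.1 d.1) }
    let M' : GroupoidCrossedModule C.Obj :=
      { toOpGroups := C.ops 0
        bdry := C.bdryTwo
        bdry_act := C.bdryTwo_act
        peiffer := C.peiffer }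
    obtain ⟨f, ⟨f_act, f_bdry, f_X⟩, -⟩ :=
      hX M (fun x r => (⟨r.1, hXS x r.1 r.2⟩ : S x)) (fun _ _ => rfl)
    have h := (hX M' (fun x r => r.1) (fun _ _ => rfl)).unique
      (y₁ := fun x => (S x).subtype.comp (f x)) (y₂ := fun x => MonoidHom.id _)
      ⟨fun x y a c => congrArg Subtype.val (f_act x y a c), f_bdry,
        fun x r => congrArg Subtype.val (f_X x r)⟩
      ⟨fun _ _ _ _ => rfl, fun _ _ => rfl, fun _ _ => rfl⟩
    have h' : (f x c).1 = c := DFunLike.congr_fun (congrFun h x) c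
    exact h' ▸ (f x c).2
  | succ n =>
    obtain ⟨f, ⟨f_act, f_X⟩, -⟩ :=
      hX ((C.ops (n + 1)).sub S hS) (fun x c d => Subtype.ext (C.comm n x c.1 d.1))
        (fun x d c => Subtype.ext (C.bdryTwo_act_trivial n d c.1))
        (fun x r => (⟨r.1, hXS x r.1 r.2⟩ : S x))
    have h := (hX (C.ops (n + 1)) (C.comm n) (fun _ => C.bdryTwo_act_trivial n)
        (fun x r => r.1)).unique
      (y₁ := fun x => (S x).subtype.comp (f x)) (y₂ := fun x => MonoidHom.id _)
      ⟨fun x y a c => congrArg Subtype.val (f_act x y a c),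
        fun x r => congrArg Subtype.val (f_X x r)⟩
      ⟨fun _ _ _ _ => rfl, fun _ _ => rfl⟩
    have h' : (f x c).1 = c := DFunLike.congr_fun (congrFun h x) c
    exact h' ▸ (f x c).2

/-! ### Coverings -/

namespace Hom.IsCovering

variable {C D : CrossedComplex.{u}} {p : Hom C D} (hp : p.IsCovering)

include hp

theorem exists_lift (x : C.Obj) {v : D.Obj} (a : p.functor.obj x ⟶ v) :
    ∃ (y : C.Obj) (hy : p.functor.obj y = v) (b : x ⟶ y),
      p.functor.map b = a ≫ eqToHom hy.symm := by
  obtain ⟨⟨y, b⟩, h⟩ := (hp.star x).2 (Quiver.Star.mk a)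
  cases h
  exact ⟨y, rfl, b, (Category.comp_id _).symm⟩

theorem map_injective {x y : C.Obj} {a b : x ⟶ y}
    (h : p.functor.map a = p.functor.map b) : a = b := by
  have h' : Quiver.Star.mk a = Quiver.Star.mk b :=
    (hp.star x).1 (congrArg Quiver.Star.mk h)
  cases h'
  rfl

/-- An arrow over an identity is an identity. -/
theorem eq_eqToHom {x y : C.Obj} (a : x ⟶ y) (h : p.functor.obj x = p.functor.obj y)
    (ha : p.functor.map a = eqToHom h) : ∃ h' : x = y, a = eqToHom h' := by
  have h₁ : Quiver.Star.mk (p.functor.map a) = Quiver.Star.mk (p.functor.map (𝟙 x)) := by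
    have h₀ : ∀ {u v : D.Obj} (h : u = v), Quiver.Star.mk (eqToHom h) = Quiver.Star.mk (𝟙 u) := by
      rintro u v rfl
      rfl
    rw [ha, p.functor.map_id, h₀]
  have h₂ : Quiver.Star.mk a = Quiver.Star.mk (𝟙 x) := (hp.star x).1 h₁
  cases h₂
  exact ⟨rfl, rfl⟩

/-- The arrows of the base all of whose lifts lie in a given subgroupoid. -/
def pushSubgroupoid (S : Subgroupoid C.Obj) : Subgroupoid D.Obj where
  arrows u v := {a | ∀ (x y : C.Obj) (hx : p.functor.obj x = u) (hy : p.functor.obj y = v)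
    (b : x ⟶ y), p.functor.map b = eqToHom hx ≫ a ≫ eqToHom hy.symm → b ∈ S.arrows x y}
  inv := by
    intro u v a ha y x hy hx b hb
    rw [← S.inv_mem_iff]
    apply ha x y hx hy
    rw [Groupoid.inv_eq_inv, Functor.map_inv]
    simp only [hb, Groupoid.inv_eq_inv]
    simp
  mul := by
    intro u v w a ha a' ha' x z hx hz b hb
    subst hx hz
    obtain ⟨y, rfl, c, hc⟩ := hp.exists_lift x a
    rw [← S.mul_mem_cancel_left (S.inv (ha x y rfl rfl c (by simpa using hc)))]
    apply ha' y z rfl rfl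
    rw [Functor.map_comp, Groupoid.inv_eq_inv, Functor.map_inv, hb]
    simp only [hc]
    simp

theorem pushSubgroupoid_isWide (S : Subgroupoid C.Obj) (hS : S.IsWide) :
    (hp.pushSubgroupoid S).IsWide where
  wide u x y hx hy b hb := by
    obtain ⟨rfl, rfl⟩ := hp.eq_eqToHom b (hx.trans hy.symm) (by simpa using hb)
    exact hS.wide x

/-- The elements of the base all of whose lifts lie in a given family of subgroups.  The lifts
are taken at all objects `x` with `p x = u`; the operation of `eqToHom` identifies the groups at
`p x` and `u`. -/
def pushSubgroup {k : ℕ} (S : ∀ x, Subgroup ((C.ops k).carrier x)) (u : D.Obj) :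
    Subgroup ((D.ops k).carrier u) where
  carrier := {c | ∀ (x : C.Obj) (hx : p.functor.obj x = u) (d : (C.ops k).carrier x),
    (D.ops k).act (eqToHom hx) (p.map k x d) = c → d ∈ S x}
  one_mem' := by
    rintro x rfl d hd
    rw [eqToHom_refl, OpGroups.act_id, ← map_one (p.map k x)] at hd
    exact (hp.groups k x).1 hd ▸ (S x).one_mem
  mul_mem' := by
    rintro a b ha hb x rfl d hd
    obtain ⟨a, rfl⟩ := (hp.groups k x).2 a
    obtain ⟨b, rfl⟩ := (hp.groups k x).2 b
    rw [eqToHom_refl, OpGroups.act_id, ← map_mul] at hd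
    exact (hp.groups k x).1 hd ▸ (S x).mul_mem (ha x rfl a (OpGroups.act_id _ _ _))
      (hb x rfl b (OpGroups.act_id _ _ _))
  inv_mem' := by
    rintro a ha x rfl d hd
    rw [← inv_mem_iff]
    apply ha x rfl
    rw [map_inv, map_inv, hd, inv_inv]

theorem act_mem_pushSubgroup {k : ℕ} (S : ∀ x, Subgroup ((C.ops k).carrier x))
    (hS : ∀ {x y : C.Obj} (a : x ⟶ y), ∀ c ∈ S x, (C.ops k).act a c ∈ S y)
    {u v : D.Obj} (a : u ⟶ v) (c : (D.ops k).carrier u) (hc : c ∈ hp.pushSubgroup S u) :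
    (D.ops k).act a c ∈ hp.pushSubgroup S v := by
  rintro y rfl d hd
  obtain ⟨x, rfl, b, hb⟩ := hp.exists_lift y (Groupoid.inv a)
  rw [eqToHom_refl, Category.comp_id] at hb
  have h := hS (Groupoid.inv b) _ (hc x rfl ((C.ops k).act b d) (by
    rw [eqToHom_refl, OpGroups.act_id] at hd ⊢
    rw [p.map_act, hb, hd, ← OpGroups.act_comp, Groupoid.comp_inv, OpGroups.act_id]))
  rwa [← OpGroups.act_comp, Groupoid.comp_inv, OpGroups.act_id] at h

/-- The inverse image under a covering of a free basis of the groupoid in dimension one, and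
likewise a free basis of the covering groupoid, generates the covering groupoid. -/
theorem mem_subgroupoid {X : D.GradedSubset} (hX : D.IsFreeInDim X 1) {Y : C.GradedSubset}
    (hY : Y = p.preimage X ∨ C.IsFreeInDim Y 1) (S : Subgroupoid C.Obj) (hS : S.IsWide)
    (hYS : ∀ x y, Y.arr x y ⊆ S.arrows x y) {x y : C.Obj} (a : x ⟶ y) : a ∈ S.arrows x y := by
  rcases hY with rfl | hY
  · refine (hp.pushSubgroupoid S).mem_of_isFreeGroupoidOn hX (hp.pushSubgroupoid_isWide S hS)
      ?_ (p.functor.map a) x y rfl rfl a (by simp)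
    rintro u v e he x y rfl rfl b hb
    apply hYS x y
    rw [eqToHom_refl, eqToHom_refl, Category.comp_id, Category.id_comp] at hb
    change p.functor.map b ∈ X.arr _ _
    rwa [hb]
  · exact S.mem_of_isFreeGroupoidOn hY hS hYS a

/-- The inverse image under a covering of a free basis in dimension `k + 2`, and likewise a free
basis of the covering complex, generates the groups of the covering complex in that dimension. -/
theorem mem_subgroup {k : ℕ} {X : D.GradedSubset} (hX : D.IsFreeInDim X (k + 2))
    {Y : C.GradedSubset} (hY : Y = p.preimage X ∨ C.IsFreeInDim Y (k + 2))
    (S : ∀ x, Subgroup ((C.ops k).carrier x))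
    (hS : ∀ {x y : C.Obj} (a : x ⟶ y), ∀ c ∈ S x, (C.ops k).act a c ∈ S y)
    (hYS : ∀ x, ∀ c ∈ Y.elt k x, c ∈ S x) {x : C.Obj} (c : (C.ops k).carrier x) : c ∈ S x := by
  rcases hY with rfl | hY
  · refine mem_of_isFreeInDim hX (hp.pushSubgroup S) (hp.act_mem_pushSubgroup S hS) ?_
      (p.map k x c) x rfl c (OpGroups.act_id _ _ _)
    rintro u e he x rfl d hd
    apply hYS x
    rw [eqToHom_refl, OpGroups.act_id] at hd
    change p.map k x d ∈ X.elt k _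
    rwa [hd]
  · exact mem_of_isFreeInDim hY S hS hYS c

theorem map_mem_bdryKer_iff (k : ℕ) {x : C.Obj} (c : (C.ops k).carrier x) :
    p.map k x c ∈ D.bdryKer k (p.functor.obj x) ↔ c ∈ C.bdryKer k x := by
  cases k with
  | zero =>
    change D.bdryTwo _ _ = 𝟙 _ ↔ C.bdryTwo _ _ = 𝟙 _
    rw [← p.map_bdryTwo, ← p.functor.map_id]
    exact ⟨fun h => hp.map_injective h, fun h => congrArg p.functor.map h⟩
  | succ n =>
    change D.bdry _ _ _ = 1 ↔ C.bdry _ _ _ = 1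
    rw [← p.map_bdry, map_eq_one_iff _ (hp.groups n x).1]

end Hom.IsCovering

theorem commute_of_mem_bdryKer_zero {C : CrossedComplex.{u}} {x : C.Obj}
    {z : (C.ops 0).carrier x} (hz : z ∈ C.bdryKer 0 x) (c : (C.ops 0).carrier x) :
    Commute z c := by
  have h := C.act_bdryTwo_of_mem 0 c hz
  rw [C.peiffer, mul_assoc, inv_mul_eq_iff_eq_mul] at h
  exact h

end CrossedComplex

/-! ### Loops and syzygies of a contracting homotopy -/

namespace PartialContractingHomotopy

variable {C : CrossedComplex.{u}} {m : ℕ} (H : PartialContractingHomotopy C m)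

theorem loop_id (x : C.Obj) : H.loop (𝟙 x) = 𝟙 H.base := by
  simp [loop]

theorem loop_comp {x y z : C.Obj} (a : x ⟶ y) (b : y ⟶ z) :
    H.loop (a ≫ b) = H.loop a ≫ H.loop b := by
  simp [loop]

theorem loop_inv {x y : C.Obj} (a : x ⟶ y) :
    H.loop (Groupoid.inv a) = Groupoid.inv (H.loop a) := by
  simp [loop, Groupoid.inv_eq_inv]

theorem hone_id (hm : 1 < m) (x : C.Obj) : H.hone (𝟙 x) = 1 := by
  have h := H.hone_comp hm (𝟙 x) (𝟙 x)
  rwa [Category.comp_id, left_eq_mul] at h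

theorem hone_inv (hm : 1 < m) {x y : C.Obj} (a : x ⟶ y) :
    H.hone (Groupoid.inv a) = (H.hone a)⁻¹ := by
  rw [eq_inv_iff_mul_eq_one, ← H.hone_comp hm, Groupoid.inv_comp, H.hone_id hm]

theorem bdryTwo_hone_eq_loop (hm : 1 < m) {x y : C.Obj} (a : x ⟶ y) :
    C.bdryTwo H.base (H.hone a) = H.loop a :=
  H.bdryTwo_hone hm a

theorem comp_hzero {x y : C.Obj} (a : x ⟶ y) : a ≫ H.hzero y = H.hzero x ≫ H.loop a := by
  simp [loop]

theorem syzygy_mem_bdryKer {k : ℕ} (hk : k + 2 ≤ m) {x : C.Obj} (c : (C.ops k).carrier x) :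
    H.syzygy k x c ∈ C.bdryKer k H.base := by
  match k with
  | 0 =>
    change C.bdryTwo _ (_⁻¹ * _) = 1
    rw [map_mul, map_inv, H.bdryTwo_hone (by omega), C.bdryTwo_act, inv_mul_cancel]
  | 1 =>
    change C.bdry 0 _ (_⁻¹ * _) = 1
    have h : C.bdryTwo x (C.bdry 0 x c) = 𝟙 x := C.bdryTwo_bdry x c
    rw [map_mul, map_inv, H.bdry_h_zero (by omega), C.bdry_act, h, H.hone_id (by omega), inv_one,
      one_mul, inv_mul_cancel]
  | n + 2 =>
    change C.bdry (n + 1) _ (_⁻¹ * _) = 1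
    rw [map_mul, map_inv, H.bdry_h_succ n (by omega), C.bdry_act, C.bdry_bdry, map_one, inv_one,
      one_mul, inv_mul_cancel]

theorem syzygy_mul {k : ℕ} (hk : k + 2 ≤ m) {x : C.Obj} (c d : (C.ops k).carrier x) :
    H.syzygy k x (c * d) = H.syzygy k x c * H.syzygy k x d := by
  cases k with
  | zero =>
    have h := CrossedComplex.commute_of_mem_bdryKer_zero (H.syzygy_mem_bdryKer hk c)
      (H.hone (C.bdryTwo x d))⁻¹
    have h₁ : H.hone (C.bdryTwo x c * C.bdryTwo x d) =
        H.hone (C.bdryTwo x c) * H.hone (C.bdryTwo x d) :=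
      H.hone_comp (by omega) _ _
    calc H.syzygy 0 x (c * d)
        = (H.hone (C.bdryTwo x d))⁻¹ * H.syzygy 0 x c * (C.ops 0).act (H.hzero x) d := by
          simp only [syzygy, map_mul, h₁, mul_inv_rev, mul_assoc]
      _ = H.syzygy 0 x c * H.syzygy 0 x d := by
          rw [← h.eq, mul_assoc]
          rfl
  | succ n =>
    let _ : CommGroup ((C.ops (n + 1)).carrier H.base) :=
      { (C.ops (n + 1)).group H.base with mul_comm := C.comm n H.base }
    simp only [syzygy, map_mul]
    rw [mul_inv]
    exact mul_mul_mul_comm _ _ _ _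

/-- In the dimensions of the truncated complex the formation of syzygies is a homomorphism on each
group. -/
def syzygyHom {k : ℕ} (hk : k + 2 ≤ m) (x : C.Obj) :
    (C.ops k).carrier x →* (C.ops k).carrier H.base :=
  MonoidHom.mk' (H.syzygy k x) (H.syzygy_mul hk)

/-- Syzygies are invariant under the operation of the groupoid: `h₀` turns the arrow `a` into a loop
which is the boundary of `h₁ a`. -/
theorem syzygy_act {k : ℕ} (hk : k + 2 ≤ m) {x y : C.Obj} (a : x ⟶ y)
    (c : (C.ops k).carrier x) : H.syzygy k y ((C.ops k).act a c) = H.syzygy k x c := by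
  have h₁ : (C.ops k).act (H.hzero y) ((C.ops k).act a c) =
      (C.ops k).act (C.bdryTwo H.base (H.hone a)) ((C.ops k).act (H.hzero x) c) := by
    rw [← OpGroups.act_comp, ← OpGroups.act_comp, H.comp_hzero,
      H.bdryTwo_hone_eq_loop (by omega)]
  match k with
  | 0 =>
    -- The syzygy of `c ^ a` is the conjugate by `h₁ a` of that of `c`, which is central.
    have h := CrossedComplex.commute_of_mem_bdryKer_zero (H.syzygy_mem_bdryKer hk c) (H.hone a)
    have h₂ : H.syzygy 0 y ((C.ops 0).act a c) =
        (H.hone a)⁻¹ * H.syzygy 0 x c * H.hone a := by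
      simp only [syzygy, h₁]
      rw [C.peiffer, C.bdryTwo_act, H.hone_comp (by omega), H.hone_comp (by omega),
        H.hone_inv (by omega)]
      group
    rw [h₂, mul_assoc, h.eq, inv_mul_cancel_left]
  | 1 =>
    simp only [syzygy, h₁]
    rw [C.bdryTwo_act_trivial, C.bdry_act, H.h_act 0 (by omega)]
  | n + 2 =>
    simp only [syzygy, h₁]
    rw [C.bdryTwo_act_trivial, C.bdry_act, H.h_act (n + 1) (by omega)]

theorem syzygy_of_mem {k : ℕ} (hk : k + 2 ≤ m) {x : C.Obj} {c : (C.ops k).carrier x}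
    (hc : c ∈ C.bdryKer k x) : H.syzygy k x c = (C.ops k).act (H.hzero x) c := by
  cases k with
  | zero =>
    have hc' : C.bdryTwo x c = 𝟙 x := hc
    rw [syzygy, hc', H.hone_id (by omega), inv_one, one_mul]
  | succ n =>
    have hc' : C.bdry n x c = 1 := hc
    rw [syzygy, hc', map_one, inv_one, one_mul]

/-- Every element of the kernel of the boundary at the base is a syzygy. -/
theorem exists_syzygy_eq {k : ℕ} (hk : k + 2 ≤ m) {c : (C.ops k).carrier H.base}
    (hc : c ∈ C.bdryKer k H.base) : ∃ d : (C.ops k).carrier H.base, H.syzygy k H.base d = c := by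
  refine ⟨(C.ops k).act (Groupoid.inv (H.hzero H.base)) c, ?_⟩
  rw [H.syzygy_of_mem hk (C.act_mem_bdryKer k _ hc), ← OpGroups.act_comp, Groupoid.inv_comp,
    OpGroups.act_id]

end PartialContractingHomotopy

/-! ### Generators of the kernels -/

/-- A set which generates the kernel of the boundary as a group generates it as a `G`-module. -/
theorem FreeCrossedResolution.kerGeneratedBy_of_le_closure {G : Type u} [Group G] {m : ℕ}
    (R : FreeCrossedResolution G m) (hm : 2 ≤ m) {k : ℕ} {x : R.C.Obj}
    {W : Set ((R.C.ops k).carrier x)} (hW : ∀ w ∈ W, w ∈ R.C.bdryKer k x)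
    (h : R.C.bdryKer k x ≤ Subgroup.closure W) : R.KerGeneratedBy hm k x W := by
  let val : (R.kerRep hm k x).asModule → (R.C.ops k).carrier x :=
    fun v => (((R.kerRep hm k x).asModuleEquiv v).toMul : (R.C.ops k).carrier x)
  have val_inj : Function.Injective val := fun v w hvw =>
    (R.kerRep hm k x).asModuleEquiv.injective (Additive.toMul.injective (Subtype.ext hvw))
  have key : ∀ w ∈ Subgroup.closure W,
      ∃ v ∈ Submodule.span (MonoidAlgebra ℤ Gᵐᵒᵖ) {v | val v ∈ W}, val v = w := by
    intro w hw
    induction hw using Subgroup.closure_induction with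
    | mem w hw =>
      have hv : val ((R.kerRep hm k x).asModuleEquiv.symm (Additive.ofMul ⟨w, hW w hw⟩)) = w := by
        simp [val]
      exact ⟨_, Submodule.subset_span (by rwa [Set.mem_ofPred_eq, hv]), hv⟩
    | one => exact ⟨0, zero_mem _, by simp [val]⟩
    | mul a b _ _ ha hb =>
      obtain ⟨v, hv, rfl⟩ := ha
      obtain ⟨w, hw, rfl⟩ := hb
      exact ⟨v + w, add_mem hv hw, by simp [val]⟩
    | inv a _ ha =>
      obtain ⟨v, hv, rfl⟩ := ha
      exact ⟨-v, neg_mem hv, by simp [val]⟩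
  rw [KerGeneratedBy, eq_top_iff]
  intro v _
  obtain ⟨w, hw, hwv⟩ := key (val v) (h (Subtype.property _))
  exact val_inj hwv ▸ hw

theorem mainTheorem4 {G : Type u} [Group G] {m : ℕ} (hm : 1 ≤ m)
    (R : FreeCrossedResolution G m)
    (Ct : CrossedComplex.{u}) (p : Ct.Hom R.C) (hp : p.IsUniversalCover R.φ)
    (H : PartialContractingHomotopy Ct m)
    (Xt : Ct.GradedSubset) (hXt : Xt = p.preimage R.X ∨ Ct.IsFreeInDim Xt m) :
    (m = 1 →
      (R.φ.vertexHom (p.functor.obj H.base)).ker =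
        Subgroup.normalClosure
          {u | ∃ (x y : Ct.Obj), ∃ a ∈ Xt.arr x y, u = p.functor.map (H.loop a)}) ∧
    ∀ (k : ℕ) (hk : m = k + 2),
      (∀ (x : Ct.Obj), ∀ c ∈ Xt.elt k x,
        p.map k H.base (H.syzygy k x c) ∈ R.C.bdryKer k (p.functor.obj H.base)) ∧
      R.KerGeneratedBy (by omega) k (p.functor.obj H.base)
        {w | ∃ (x : Ct.Obj), ∃ c ∈ Xt.elt k x, w = p.map k H.base (H.syzygy k x c)} := by
  obtain ⟨hcov, φ', hφ', hlift⟩ := hp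
  constructor
  · rintro rfl
    set N := Subgroup.normalClosure
      {u | ∃ (x y : Ct.Obj), ∃ a ∈ Xt.arr x y, u = p.functor.map (H.loop a)}
    apply le_antisymm
    · let S : Subgroupoid Ct.Obj :=
        { arrows := fun x y => {a | p.functor.map (H.loop a) ∈ N}
          inv := fun {x y a} ha => by
            have h := N.inv_mem ha
            rw [Set.mem_ofPred_eq, H.loop_inv, Groupoid.inv_eq_inv, Functor.map_inv,
              ← Groupoid.inv_eq_inv]
            exact h
          mul := fun {x y z a} ha {b} hb => by
            have h := N.mul_mem ha hb
            rw [Set.mem_ofPred_eq, H.loop_comp, Functor.map_comp]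
            exact h }
      have hS : S.IsWide := ⟨fun x => by
        change p.functor.map (H.loop (𝟙 x)) ∈ N
        rw [H.loop_id, CategoryTheory.Functor.map_id]
        exact N.one_mem⟩
      have hXS : ∀ x y, Xt.arr x y ⊆ S.arrows x y := fun x y a ha =>
        Subgroup.subset_normalClosure ⟨x, y, a, ha, rfl⟩
      intro a ha
      obtain ⟨y, hy, b, hb⟩ := hcov.exists_lift H.base a
      -- The lift of `a` is a loop, as its target in the universal covering groupoid is `φ a = 1`
      -- times its source.
      obtain rfl : H.base = y := by
        apply hφ'.1
        have h₁ : (φ'.map b).1 = R.φ.map (p.functor.map b) := hlift b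
        have h₂ := (φ'.map b).2
        have h₃ : R.φ.map (p.functor.map b) = 1 := by
          have h₀ : ∀ {u v : R.C.Obj} (h : u = v), R.φ.map (eqToHom h) = 1 := by
            rintro u v rfl
            exact R.φ.map_id u
          have ha' : R.φ.map a = 1 := ha
          rw [hb, R.φ.map_comp, ha', h₀, mul_one]
        rw [h₁, h₃, mul_one] at h₂
        cases h : φ'.obj H.base
        cases h' : φ'.obj y
        rw [h, h'] at h₂
        exact congrArg _ h₂
      rw [eqToHom_refl, Category.comp_id] at hb
      have h := hcov.mem_subgroupoid (R.free 1 le_rfl le_rfl) hXt S hS hXS b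
      change p.functor.map (H.loop b) ∈ N at h
      have h' := Subgroup.normalClosure_normal.conj_mem _ h (p.functor.map (H.hzero H.base))
      convert h'
      rw [← hb]
      change p.functor.map b = (p.functor.map (H.hzero H.base) ≫ p.functor.map (H.loop b)) ≫
        Groupoid.inv (p.functor.map (H.hzero H.base))
      rw [← Functor.map_comp, ← H.comp_hzero, Functor.map_comp, Category.assoc,
        Groupoid.comp_inv, Category.comp_id]
    · apply Subgroup.normalClosure_le_normal
      rintro _ ⟨x, y, a, -, rfl⟩
      change R.φ.map _ = 1
      rw [← hlift]
      exact mul_eq_left.mp (φ'.map (H.loop a)).2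
  · rintro k rfl
    have hker : ∀ (x : Ct.Obj) (c : (Ct.ops k).carrier x),
        p.map k H.base (H.syzygy k x c) ∈ R.C.bdryKer k (p.functor.obj H.base) := fun x c =>
      (hcov.map_mem_bdryKer_iff k _).2 (H.syzygy_mem_bdryKer le_rfl c)
    refine ⟨fun x c _ => hker x c, R.kerGeneratedBy_of_le_closure _ ?_ ?_⟩
    · rintro _ ⟨x, c, -, rfl⟩
      exact hker x c
    · intro w hw
      obtain ⟨w, rfl⟩ := (hcov.groups k H.base).2 w
      obtain ⟨d, rfl⟩ := H.exists_syzygy_eq le_rfl ((hcov.map_mem_bdryKer_iff k w).1 hw)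
      refine hcov.mem_subgroup (R.free (k + 2) hm le_rfl) hXt
        (fun x => (Subgroup.closure _).comap ((p.map k H.base).comp (H.syzygyHom le_rfl x)))
        ?_ ?_ d
      · intro x y a c hc
        rw [Subgroup.mem_comap] at hc ⊢
        exact (congrArg (p.map k H.base) (H.syzygy_act le_rfl a c)).symm ▸ hc
      · exact fun x c hc => Subgroup.subset_closure ⟨x, c, hc, rfl⟩
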